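/- Let $F:\mathcal A\to\mathcal B$ be a functor from an additive category $\mathcal A$ to an abelian category $\mathcal B$ with $F(0_{\mathcal A})=0_{\mathcal B}$, and let $C_\bullet$ be a chain complex in $\mathcal A$ concentrated in non-negative degrees. Definitions. For morphisms $f_1,\dots,f_n:X\to Y$ in $\mathcal A$ put $$F(f_1\top\cdots\top f_n)=\sum_{k=1}^{n}\ \sum_{j_1<\cdots<j_k}(-1)^{n-k}F(f_{j_1}+\cdots+f_{j_k}).$$ The $n$-th cross-effect functor $\mathrm{cr}_n(F):\mathcal A^n\to\mathcal B$ sends $(A_1,\dots,A_n)$ to the image of the endomorphism $F(\psi_1\top\cdots\top\psi_n)$ of $F(A_1\oplus\cdots\oplus A_n)$, where $\psi_j$ is the endomorphism of $A_1\oplus\cdots\oplus A_n$ that keeps the $j$-th coordinate and annihilates the others; on morphisms it is induced by $F(f_1\oplus\cdots\oplus f_n)$. (In particular $\mathrm{cr}_0(F)=0$.) The degree $d\in\{0,1,2,\dots\}\cup\{\infty\}$ of $F$ is the least $d$ such that $\mathrm{cr}_{d+1}(F)$ is the zero functor, and $\infty$ if there is none. The length of a non-negatively graded chain complex $D_\bullet$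 is the least $l\in\{0,1,2,\dots\}$ such that $D_n=0$ for all $n>l$, and $\infty$ if there is none (so the zero complex has length $0$). $\Gamma(C_\bullet)$ is the simplicial object in $\mathcal A$ with $\Gamma(C_\bullet)_n=\bigoplus_{k=0}^n\bigoplus_{\mu:[n]\twoheadrightarrow[k]}C_k$ given by the Dold-Kan correspondence, $F$ is applied to it degreewise, and for a simplicial object $X_\bullet$ in $\mathcal B$ the normalized complex $N(X_\bullet)$ has $N(X_\bullet)_n=X_n\big/\sum_{i=0}^{n-1}\mathrm{Im}(s_i)$ with differential induced by $\sum_i(-1)^id_i$. Statement. Let $l$ be the length of $C_\bullet$ and $d$ the degree of $F$. Then the length of the Dold-Puppe complex $NF\Gamma(C_\bullet)$ is at most $l\cdot d$ (in $\{0,1,2,\dots\}\cup\{\infty\}$ with $0\cdot\infty=0$). If moreover $l$ and $d$ are finite and the object $\mathrm{cr}_d(F)(C_l,\dots,C_l)$ is not zero, then the length of $NF\Gamma(C_\bullet)$ equals $l\cdot d$. -/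

import Mathlib

open CategoryTheory CategoryTheory.Limits AlgebraicTopology Simplicial

universe v₁ v₂ u₁ u₂

namespace DoldPuppe

/-! ### Cross-effect functors -/

section CrossEffect

variable {A : Type u₁} [Category.{v₁} A] [Preadditive A]
  {B : Type u₂} [Category.{v₂} B]

/-- The deviation `F(f₁ ⊤ ⋯ ⊤ fₙ) = ∑ (-1)^(n-k) F(f_{j₁} + ⋯ + f_{jₖ})`, where the sum is over
all non-empty subsets `{j₁ < ⋯ < jₖ}` of the index set. -/
noncomputable def deviation [Preadditive B] (F : A ⥤ B) {n : ℕ} {X Y : A}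
    (f : Fin n → (X ⟶ Y)) : F.obj X ⟶ F.obj Y :=
  ∑ s ∈ (Finset.univ : Finset (Finset (Fin n))) with s.Nonempty,
    (-1 : ℤ) ^ (n - s.card) • F.map (∑ j ∈ s, f j)

variable [HasFiniteBiproducts A]

/-- The endomorphism `ψⱼ` of `A₁ ⊕ ⋯ ⊕ Aₙ` that keeps the `j`-th coordinate and replaces all
other coordinates by zero. -/
noncomputable def psi {n : ℕ} (X : Fin n → A) (j : Fin n) : (⨁ X) ⟶ (⨁ X) :=
  biproduct.π X j ≫ biproduct.ι X j

theorem map_comp_deviation_psi [Preadditive B] (F : A ⥤ B) {n : ℕ} {X Y : Fin n → A}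
    (f : ∀ j, X j ⟶ Y j) :
    F.map (biproduct.map f) ≫ deviation F (psi Y) =
      deviation F (psi X) ≫ F.map (biproduct.map f) := by
  have h : ∀ j : Fin n, biproduct.map f ≫ psi Y j = psi X j ≫ biproduct.map f := by
    intro j
    simp [psi]
  unfold deviation
  rw [Preadditive.comp_sum, Preadditive.sum_comp]
  refine Finset.sum_congr rfl fun s _ => ?_
  rw [Preadditive.comp_zsmul, Preadditive.zsmul_comp, ← F.map_comp, ← F.map_comp,
    Preadditive.comp_sum, Preadditive.sum_comp]
  simp only [h]

/-- The functor sending `(A₁, …, Aₙ)` to the endomorphism `F(ψ₁ ⊤ ⋯ ⊤ ψₙ)` of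
`F(A₁ ⊕ ⋯ ⊕ Aₙ)`, and `(f₁, …, fₙ)` to `F(f₁ ⊕ ⋯ ⊕ fₙ)` on source and target. -/
noncomputable def psiDeviation [Preadditive B] (F : A ⥤ B) (n : ℕ) : (Fin n → A) ⥤ Arrow B where
  obj X := Arrow.mk (deviation F (psi X))
  map f := Arrow.homMk (F.map (biproduct.map f)) (F.map (biproduct.map f))
    (map_comp_deviation_psi F f)
  map_id X := by
    have h : biproduct.map (𝟙 X : X ⟶ X) = 𝟙 (⨁ X) := by
      ext; simp
    ext <;> simp [h]
  map_comp f g := by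
    have h : biproduct.map (f ≫ g) = biproduct.map f ≫ biproduct.map g := by
      ext; simp
    ext <;> simp [h]

/-- The `n`-th cross-effect functor of `F`: on objects it is the image of the endomorphism
`F(ψ₁ ⊤ ⋯ ⊤ ψₙ)` of `F(A₁ ⊕ ⋯ ⊕ Aₙ)`, and on morphisms it is induced by
`F(f₁ ⊕ ⋯ ⊕ fₙ)`. -/
noncomputable def crossEffect [Abelian B] (F : A ⥤ B) (n : ℕ) : (Fin n → A) ⥤ B :=
  psiDeviation F n ⋙ Limits.im

/-- `F` is of degree less than `n` if its `n`-th cross-effect is the zero functor. -/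
def HasDegreeLT [Abelian B] (F : A ⥤ B) (n : ℕ) : Prop :=
  IsZero (crossEffect F n)

/-- The degree of `F`: the least natural number `d` such that `F` is of degree less than `d + 1`,
and infinity if there is no such `d`. -/
noncomputable def degree [Abelian B] (F : A ⥤ B) : ℕ∞ :=
  ⨅ (d : ℕ) (_ : HasDegreeLT F (d + 1)), (d : ℕ∞)

end CrossEffect

/-! ### The normalized chain complex of a simplicial object -/

section Normalized

variable {B : Type u₂} [Category.{v₂} B] [Abelian B] (X : SimplicialObject B)

/-- The sum of the images of all degeneracy operators `Xₙ₋₁ ⟶ Xₙ`. -/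
noncomputable def degenerate (n : ℕ) : Subobject (X _⦋n⦌) :=
  match n with
  | 0 => ⊥
  | n + 1 => Finset.univ.sup fun i : Fin (n + 1) => imageSubobject (X.σ i)

/-- The object `N(X)ₙ = Xₙ / ∑ᵢ Im sᵢ`. -/
noncomputable def normalizedX (n : ℕ) : B :=
  cokernel (degenerate X n).arrow

/-- The quotient map `Xₙ ⟶ N(X)ₙ`. -/
noncomputable def normalizedπ (n : ℕ) : X _⦋n⦌ ⟶ normalizedX X n :=
  cokernel.π _

instance (n : ℕ) : Epi (normalizedπ X n) :=
  inferInstanceAs (Epi (cokernel.π (degenerate X n).arrow))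

theorem degenerate_arrow_normalizedπ (n : ℕ) : (degenerate X n).arrow ≫ normalizedπ X n = 0 :=
  cokernel.condition _

theorem σ_normalizedπ {n : ℕ} (i : Fin (n + 1)) : X.σ i ≫ normalizedπ X (n + 1) = 0 := by
  have h : imageSubobject (X.σ i) ≤ degenerate X (n + 1) :=
    Finset.le_sup (f := fun i : Fin (n + 1) => imageSubobject (X.σ i)) (Finset.mem_univ i)
  rw [← imageSubobject_arrow_comp (X.σ i), ← Subobject.ofLE_arrow h, Category.assoc,
    Category.assoc, degenerate_arrow_normalizedπ, comp_zero, comp_zero]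

/-- A morphism out of `Xₙ₊₁` that vanishes on all degeneracies vanishes on their sum. -/
theorem degenerate_arrow_comp {n : ℕ} {Z : B} (g : X _⦋n + 1⦌ ⟶ Z)
    (h : ∀ i : Fin (n + 1), X.σ i ≫ g = 0) : (degenerate X (n + 1)).arrow ≫ g = 0 := by
  have hle : degenerate X (n + 1) ≤ kernelSubobject g := by
    refine Finset.sup_le fun i _ => ?_
    exact imageSubobject_le _ (factorThruKernelSubobject g (X.σ i) (h i)) (by simp)
  rw [← Subobject.ofLE_arrow hle, Category.assoc, kernelSubobject_arrow_comp, comp_zero]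

theorem σ_objD_normalizedπ {n : ℕ} (j : Fin (n + 1)) :
    X.σ j ≫ AlternatingFaceMapComplex.objD X n ≫ normalizedπ X n = 0 := by
  simp only [AlternatingFaceMapComplex.objD, Preadditive.comp_sum, Preadditive.sum_comp,
    Preadditive.comp_zsmul, Preadditive.zsmul_comp]
  have hne : (Fin.castSucc j : Fin (n + 2)) ≠ j.succ := (Fin.castSucc_lt_succ).ne
  rw [Finset.sum_eq_add (Fin.castSucc j) j.succ hne]
  · rw [X.δ_comp_σ_self_assoc, X.δ_comp_σ_succ_assoc]
    simp [pow_succ]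
  · intro i _ hi
    have key : X.σ j ≫ X.δ i ≫ normalizedπ X n = 0 := by
      cases n with
      | zero =>
        exfalso
        obtain ⟨h1, h2⟩ := hi
        rw [Ne, Fin.ext_iff] at h1 h2
        simp at h1 h2
        omega
      | succ m =>
        rcases lt_or_gt_of_ne hi.1 with hlt | hgt
        · obtain ⟨j', rfl⟩ : ∃ j' : Fin (m + 1), j = j'.succ :=
            Fin.exists_succ_eq.mpr (by
              rintro rfl
              simp at hlt) |>.imp fun _ => Eq.symm
          obtain ⟨i', rfl⟩ : ∃ i' : Fin (m + 2), i = i'.castSucc :=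
            ⟨i.castPred (by
              rintro rfl
              simp [Fin.lt_def] at hlt
              omega), by simp⟩
          rw [X.δ_comp_σ_of_le_assoc (by
            simp [Fin.lt_def, Fin.le_def] at hlt ⊢
            omega), σ_normalizedπ, comp_zero]
        · have hgt' : j.succ < i := by
            refine lt_of_le_of_ne ?_ (Ne.symm hi.2)
            simp [Fin.lt_def, Fin.le_def] at hgt ⊢
            omega
          rw [X.δ_comp_σ_of_gt'_assoc hgt', σ_normalizedπ, comp_zero]
    rw [key, smul_zero]
  · simp
  · simp

theorem degenerate_objD_normalizedπ (n : ℕ) :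
    (degenerate X (n + 1)).arrow ≫ AlternatingFaceMapComplex.objD X n ≫ normalizedπ X n = 0 :=
  degenerate_arrow_comp X _ (σ_objD_normalizedπ X)

/-- The differential of `N(X)`, induced by the alternating sum `∑ᵢ (-1)ⁱ dᵢ` of the face
operators. -/
noncomputable def normalizedD (n : ℕ) : normalizedX X (n + 1) ⟶ normalizedX X n :=
  cokernel.desc _ (AlternatingFaceMapComplex.objD X n ≫ normalizedπ X n)
    (degenerate_objD_normalizedπ X n)

theorem normalizedπ_d (n : ℕ) :
    normalizedπ X (n + 1) ≫ normalizedD X n =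
      AlternatingFaceMapComplex.objD X n ≫ normalizedπ X n :=
  cokernel.π_desc _ _ _

theorem normalizedD_comp (n : ℕ) : normalizedD X (n + 1) ≫ normalizedD X n = 0 := by
  rw [← cancel_epi (normalizedπ X (n + 1 + 1)), ← Category.assoc, normalizedπ_d, Category.assoc,
    normalizedπ_d, ← Category.assoc, AlternatingFaceMapComplex.d_squared, zero_comp, comp_zero]

/-- The normalized chain complex `N(X)` of a simplicial object `X`. -/
noncomputable def normalizedComplex : ChainComplex B ℕ :=
  ChainComplex.of (normalizedX X) (normalizedD X) (normalizedD_comp X)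

end Normalized

/-! ### Dold-Puppe complexes -/

/-- The length of a non-negatively graded chain complex: the least `l` such that `Cₙ = 0` for
all `n > l`, and infinity if there is no such `l`. -/
noncomputable def length {A : Type u₁} [Category.{v₁} A] [HasZeroMorphisms A]
    (C : ChainComplex A ℕ) : ℕ∞ :=
  ⨅ (l : ℕ) (_ : ∀ n : ℕ, l < n → IsZero (C.X n)), (l : ℕ∞)

/-- The Dold-Puppe complex `NFΓ(C)`: the functor `Γ` is Mathlib's `DoldKan.Γ₀`, with
`Γ(C)ₙ = ⨁_{[n] ↠ [k]} Cₖ`, and `F` is applied degreewise to simplicial objects. -/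
noncomputable def complex {A : Type u₁} [Category.{v₁} A] [Preadditive A] [HasFiniteBiproducts A]
    {B : Type u₂} [Category.{v₂} B] [Abelian B] (F : A ⥤ B) (C : ChainComplex A ℕ) :
    ChainComplex B ℕ :=
  normalizedComplex (((SimplicialObject.whiskering A B).obj F).obj (DoldKan.Γ₀.obj C))

end DoldPuppe

/-!
By Dold-Kan, `Γ(C)ₙ` is the direct sum of copies of `C_k` indexed by the surjections
`a : [n] ↠ [k]`. Call `i < n` a *jump* of `a` if `a i ≠ a (i + 1)`; then `a` has `k` jumps, and the
image of the degeneracy `sᵢ` is the sum of the summands whose index has no jump at `i`. Let `l` be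
the length of `C` and `d` the degree of `F`.

*Upper bound.* The identity of `Γ(C)ₙ` is the sum of the idempotents `e_a` belonging to the
surjections `a : [n] ↠ [k]` with `C_k ≠ 0`, hence `k ≤ l`. As deviations of order `d + 1` vanish,
`F(∑ e_a)` is a linear combination of morphisms `F(∑_{a ∈ U} e_a)` with `|U| ≤ d`
(`map_sum_comp_eq_zero`). If `n > l * d`, the at most `l * d` jumps of the members of `U` do not
exhaust all indices (`exists_forall_castSucc_eq_succ`), so `∑_{a ∈ U} e_a` factors through some
`sᵢ`. Thus the quotient map `F(Γ(C)ₙ) ⟶ N(FΓ(C))ₙ` is zero.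

*Lower bound.* For `n = l * d`, the `d` surjections `[n] ↠ [l]` with jumps in consecutive blocks of
length `l` (`blockHom`) exhibit `C_l ⊕ ⋯ ⊕ C_l` as a retract of `Γ(C)ₙ`. The retraction composed
with any `sᵢ` has a zero component, namely that of the block containing `i`, and a deviation with a
zero entry vanishes. So `F` of the retraction followed by `F(ψ₁ ⊤ ⋯ ⊤ ψ_d)` factors through
`N(FΓ(C))ₙ`, and it is non-zero if `cr_d(F)(C_l, …, C_l) ≠ 0`.
-/

open Opposite SimplicialObject

namespace DoldPuppe

/-! ### Deviations and the degree of a functor -/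

section Deviation

variable {A : Type u₁} [Category.{v₁} A] [Preadditive A]
  {B : Type u₂} [Category.{v₂} B]

theorem comp_deviation [Preadditive B] (F : A ⥤ B) {n : ℕ} {W X Y : A} (g : W ⟶ X)
    (f : Fin n → (X ⟶ Y)) :
    F.map g ≫ deviation F f = deviation F fun j => g ≫ f j := by
  simp only [deviation, ← Preadditive.comp_sum, F.map_comp, ← Preadditive.comp_zsmul]

theorem deviation_comp [Preadditive B] (F : A ⥤ B) {n : ℕ} {X Y Z : A}
    (f : Fin n → (X ⟶ Y)) (g : Y ⟶ Z) :
    deviation F f ≫ F.map g = deviation F fun j => f j ≫ g := by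
  simp only [deviation, ← Preadditive.sum_comp, F.map_comp, ← Preadditive.zsmul_comp]

variable [HasFiniteBiproducts A]

theorem map_zero_of_isZero [HasZeroMorphisms B] (F : A ⥤ B)
    (hF : ∀ Z : A, IsZero Z → IsZero (F.obj Z)) (X Y : A) : F.map (0 : X ⟶ Y) = 0 := by
  have h : (0 : X ⟶ Y) = (0 : X ⟶ ⨁ (Fin.elim0 : Fin 0 → A)) ≫ 0 := by simp
  have hZ : IsZero (⨁ (Fin.elim0 : Fin 0 → A)) := by
    rw [IsZero.iff_id_eq_zero]
    ext j
    exact j.elim0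
  rw [h, F.map_comp, (hF _ hZ).eq_of_tgt (F.map 0) 0, zero_comp]

/-- The terms of a deviation with a zero entry `f j` cancel in pairs `s`, `s ∪ {j}`. -/
theorem deviation_eq_zero_of_apply_eq_zero [Preadditive B] (F : A ⥤ B)
    (hF : ∀ Z : A, IsZero Z → IsZero (F.obj Z)) {n : ℕ} {X Y : A} (f : Fin n → (X ⟶ Y))
    {j : Fin n} (hj : f j = 0) : deviation F f = 0 := by
  classical
  have h : deviation F f = ∑ s ∈ (Finset.univ : Finset (Fin n)).powerset,
      (-1 : ℤ) ^ (n - s.card) • F.map (∑ j ∈ s, f j) := by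
    rw [deviation, Finset.powerset_univ]
    refine Finset.sum_filter_of_ne fun s _ hs => ?_
    by_contra hne
    rw [Finset.not_nonempty_iff_eq_empty] at hne
    subst hne
    exact hs (by rw [Finset.sum_empty, map_zero_of_isZero F hF, smul_zero])
  rw [h, ← Finset.insert_erase (Finset.mem_univ j),
    Finset.sum_powerset_insert (Finset.notMem_erase _ _), ← Finset.sum_add_distrib]
  refine Finset.sum_eq_zero fun s hs => ?_
  have hjs : j ∉ s := fun h => Finset.notMem_erase j _ (Finset.mem_powerset.1 hs h)
  have hcard : s.card + 1 ≤ n := by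
    rw [← Finset.card_insert_of_notMem hjs]
    exact card_finset_fin_le _
  obtain ⟨k, hk⟩ := Nat.exists_eq_add_of_le hcard
  rw [Finset.card_insert_of_notMem hjs, Finset.sum_insert hjs, hj, zero_add,
    show n - s.card = k + 1 by omega, show n - (s.card + 1) = k by omega, ← add_smul, pow_succ]
  simp

theorem isZero_crossEffect_obj_iff [Abelian B] (F : A ⥤ B) {n : ℕ} (X : Fin n → A) :
    IsZero ((crossEffect F n).obj X) ↔ deviation F (psi X) = 0 := by
  change IsZero (image (deviation F (psi X))) ↔ _
  constructor
  · intro h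
    rw [← image.fac (deviation F (psi X)), h.eq_of_tgt (factorThruImage _) 0, zero_comp]
  · intro h
    rw [h]
    exact (isZero_zero B).of_iso imageZero

/-- Every deviation of order `n` factors through `F(ψ₁ ⊤ ⋯ ⊤ ψₙ)` on `Y ⊕ ⋯ ⊕ Y`, via the
morphism with components `f` and the codiagonal. -/
theorem HasDegreeLT.deviation_eq_zero [Abelian B] {F : A ⥤ B} {n : ℕ} (h : HasDegreeLT F n)
    {X Y : A} (f : Fin n → (X ⟶ Y)) : deviation F f = 0 := by
  have hψ : deviation F (psi fun _ : Fin n => Y) = 0 :=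
    (isZero_crossEffect_obj_iff F _).1 (h.obj _)
  have hf : f = fun j => (biproduct.lift f ≫ psi (fun _ : Fin n => Y) j) ≫
      biproduct.desc fun _ => 𝟙 Y := by
    funext j
    simp [psi]
  rw [hf, ← deviation_comp, ← comp_deviation, hψ, comp_zero, zero_comp]

/-- If all deviations of order `d + 1` vanish, then `F(∑ h)` is a linear combination of the
`F(∑_{a ∈ U} h a)` with at most `d` summands: a longer sum is grouped into `d + 1` partial sums,
and the vanishing deviation of these expresses it through shorter sums. -/
theorem map_sum_comp_eq_zero [Abelian B] (F : A ⥤ B) {d : ℕ} (hd : HasDegreeLT F (d + 1))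
    {ι : Type*} {X Y : A} {Z : B} (h : ι → (X ⟶ Y)) (p : F.obj Y ⟶ Z) (J : Finset ι)
    (hp : ∀ U ⊆ J, U.card ≤ d → F.map (∑ a ∈ U, h a) ≫ p = 0) :
    F.map (∑ a ∈ J, h a) ≫ p = 0 := by
  classical
  induction J using Finset.strongInduction with | _ J ih
  rcases Nat.lt_or_ge d J.card with hJ | hJ
  swap
  · exact hp J subset_rfl hJ
  -- `c` distributes `J` over `d + 1` non-empty groups, with `g j` a member of the `j`-th.
  obtain ⟨g⟩ : Nonempty (Fin (d + 1) ↪ J) :=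
    Function.Embedding.nonempty_of_card_le (by simpa using hJ)
  have hg : Function.Injective fun j => (g j : ι) := Subtype.val_injective.comp g.injective
  obtain ⟨c, hc⟩ : ∃ c : ι → Fin (d + 1), ∀ j, c (g j) = j :=
    ⟨_, Function.leftInverse_invFun hg⟩
  have key := congrArg (· ≫ p) (hd.deviation_eq_zero fun j => ∑ a ∈ J with c a = j, h a)
  simp only [zero_comp, deviation, Finset.sum_fiberwise_eq_sum_filter, Preadditive.sum_comp,
    Preadditive.zsmul_comp] at key
  rw [Finset.sum_eq_single Finset.univ] at key
  · simpa using key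
  · intro s _ hs
    obtain ⟨j, hj⟩ : ∃ j, j ∉ s := by
      by_contra! hall
      exact hs (Finset.eq_univ_iff_forall.2 hall)
    have hss : J.filter (fun a => c a ∈ s) ⊂ J :=
      Finset.filter_ssubset.2 ⟨g j, (g j).2, by rwa [hc]⟩
    rw [ih _ hss fun U hU => hp U (hU.trans hss.subset), smul_zero]
  · intro hs
    exact absurd (Finset.mem_filter.2 ⟨Finset.mem_univ _, Finset.univ_nonempty⟩) hs

end Deviation

/-! ### Infima of sets of natural numbers in `ℕ∞` -/

/-- A finite infimum of natural numbers in `ℕ∞` is attained. -/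
theorem of_iInf_coe_eq {p : ℕ → Prop} {m : ℕ}
    (h : ⨅ (k : ℕ) (_ : p k), (k : ℕ∞) = (m : ℕ∞)) : p m := by
  by_contra hm
  have hle : ((m + 1 : ℕ) : ℕ∞) ≤ ⨅ (k : ℕ) (_ : p k), (k : ℕ∞) := by
    refine le_iInf₂ fun k hk => Nat.cast_le.2 ?_
    have h₁ : (m : ℕ∞) ≤ k := h ▸ iInf₂_le k hk
    have h₂ : m ≠ k := by
      rintro rfl
      exact hm hk
    have h₃ : m ≤ k := Nat.cast_le.1 h₁
    omega
  rw [h, Nat.cast_le] at hle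
  omega

theorem hasDegreeLT_of_degree_eq {A : Type u₁} [Category.{v₁} A] [Preadditive A]
    [HasFiniteBiproducts A] {B : Type u₂} [Category.{v₂} B] [Abelian B] {F : A ⥤ B} {d : ℕ}
    (h : degree F = d) : HasDegreeLT F (d + 1) :=
  of_iInf_coe_eq (p := fun d => HasDegreeLT F (d + 1)) h

section Length

variable {A : Type u₁} [Category.{v₁} A] [HasZeroMorphisms A] {C : ChainComplex A ℕ}

theorem isZero_of_length_lt {n : ℕ} (h : length C < n) : IsZero (C.X n) := by
  obtain ⟨l, hl⟩ := ENat.ne_top_iff_exists.1 h.ne_top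
  rw [← hl, Nat.cast_lt] at h
  exact of_iInf_coe_eq (p := fun l => ∀ n : ℕ, l < n → IsZero (C.X n)) hl.symm n h

theorem length_le {M : ℕ∞} (h : ∀ n : ℕ, M < n → IsZero (C.X n)) : length C ≤ M := by
  cases M with
  | top => exact le_top
  | coe m => exact iInf₂_le m fun n hn => h n (Nat.cast_lt.2 hn)

end Length

/-! ### Jumps of monotone maps between finite ordinals -/

/-- A monotone map `[m + 1] → [k]` takes different values at `i` and `i + 1` for at most `k`
indices `i`, so maps with `∑ k ≤ m` have a common index `i` at which none of them jumps. -/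
theorem exists_forall_castSucc_eq_succ {ι : Type*} {m : ℕ} {k : ι → ℕ}
    (f : ∀ a, Fin (m + 2) →o Fin (k a + 1)) (U : Finset ι) (h : ∑ a ∈ U, k a < m + 1) :
    ∃ i : Fin (m + 1), ∀ a ∈ U, f a i.castSucc = f a i.succ := by
  classical
  have hcard : ∀ a, (Finset.univ.filter fun i : Fin (m + 1) =>
      f a i.castSucc ≠ f a i.succ).card ≤ k a := by
    intro a
    have hlt : ∀ i : Fin (m + 1), f a i.castSucc ≠ f a i.succ → f a i.castSucc < f a i.succ :=
      fun i hi => lt_of_le_of_ne ((f a).monotone Fin.castSucc_lt_succ.le) hi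
    refine le_of_le_of_eq (Finset.card_le_card_of_injOn (t := Finset.Ioc 0 (k a))
      (fun i => (f a i.succ : ℕ)) ?_ ?_) (Nat.card_Ioc 0 (k a))
    · intro i hi
      have hi : f a i.castSucc < f a i.succ := hlt i (Finset.mem_filter.1 hi).2
      exact Finset.mem_coe.2 (Finset.mem_Ioc.2
        ⟨(Nat.zero_le _).trans_lt (Fin.lt_def.1 hi), Nat.lt_succ_iff.1 (f a i.succ).2⟩)
    · have aux : ∀ i j : Fin (m + 1), i < j → f a j.castSucc ≠ f a j.succ →
          f a i.succ < f a j.succ :=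
        fun i j hij hj => lt_of_le_of_lt ((f a).monotone
          (Fin.le_def.2 (Nat.succ_le_of_lt (Fin.lt_def.1 hij)))) (hlt j hj)
      intro i hi j hj hij
      have hij : f a i.succ = f a j.succ := Fin.ext hij
      rcases lt_trichotomy i j with h' | h' | h'
      · exact absurd hij (aux i j h' (Finset.mem_filter.1 hj).2).ne
      · exact h'
      · exact absurd hij (aux j i h' (Finset.mem_filter.1 hi).2).ne'
  by_contra! hne
  have hcover : (Finset.univ : Finset (Fin (m + 1))) ⊆ U.biUnion fun a =>
      Finset.univ.filter fun i : Fin (m + 1) => f a i.castSucc ≠ f a i.succ := by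
    intro i _
    obtain ⟨a, ha, hi⟩ := hne i
    exact Finset.mem_biUnion.2 ⟨a, ha, by simpa using hi⟩
  have h₁ := (Finset.card_le_card hcover).trans
    (Finset.card_biUnion_le.trans (Finset.sum_le_sum fun a _ => hcard a))
  rw [Finset.card_univ, Fintype.card_fin] at h₁
  omega

/-- The monotone map `[n] → [l]` that is constant outside `j * l ≤ x ≤ (j + 1) * l`, where it
takes the values `0, …, l`. -/
def blockHom (n l j : ℕ) : Fin (n + 1) →o Fin (l + 1) where
  toFun x := ⟨min (x - j * l) l, by omega⟩
  monotone' x y h := by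
    simp only [Fin.le_def] at h ⊢
    omega

theorem val_blockHom (n l j : ℕ) (x : Fin (n + 1)) :
    (blockHom n l j x : ℕ) = min (x - j * l) l :=
  rfl

theorem blockHom_surjective {n l j : ℕ} (h : (j + 1) * l ≤ n) :
    Function.Surjective (blockHom n l j) := by
  intro y
  rw [add_mul, one_mul] at h
  refine ⟨⟨j * l + y, by omega⟩, Fin.ext ?_⟩
  rw [val_blockHom]
  dsimp only
  omega

theorem blockHom_injective {n l j j' : ℕ} (hl : 0 < l) (hj : (j + 1) * l ≤ n)
    (h : blockHom n l j = blockHom n l j') : j' ≤ j := by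
  by_contra! hlt
  have h₁ : (j + 1) * l ≤ j' * l := Nat.mul_le_mul_right l hlt
  have h₂ := congrArg Fin.val (DFunLike.congr_fun h ⟨(j + 1) * l, by omega⟩)
  rw [val_blockHom, val_blockHom] at h₂
  dsimp only at h₂
  rw [add_mul, one_mul] at h₁ h₂
  omega

theorem blockHom_castSucc_ne_succ {m l : ℕ} (hl : 0 < l) (i : Fin (m + 1)) :
    blockHom (m + 1) l (i / l) i.castSucc ≠ blockHom (m + 1) l (i / l) i.succ := by
  intro h
  have h₁ := congrArg Fin.val h
  rw [val_blockHom, val_blockHom, Fin.val_castSucc, Fin.val_succ] at h₁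
  have h₂ := Nat.div_add_mod' (i : ℕ) l
  have h₃ := Nat.mod_lt (i : ℕ) hl
  omega

/-! ### The summands of a split simplicial object -/

section Splitting

variable {A : Type u₁} [Category.{v₁} A] {X : SimplicialObject A} (s : Splitting X)
  {Δ : SimplexCategoryᵒᵖ}

/-- The summand of the `Δ`-simplices of a split simplicial object that is indexed by an
epimorphism out of `Δ`. -/
def splittingSummand (a : Splitting.IndexSet Δ) : A :=
  s.N a.1.unop.len

/-- The inclusion of a summand into the `Δ`-simplices of a split simplicial object. -/
def splittingInj (a : Splitting.IndexSet Δ) : splittingSummand s a ⟶ X.obj Δ :=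
  (s.cofan Δ).inj a

theorem splitting_hom_ext {Z : A} {f g : X.obj Δ ⟶ Z}
    (h : ∀ a, splittingInj s a ≫ f = splittingInj s a ≫ g) : f = g :=
  s.hom_ext' f g h

theorem exists_splittingInj_eq_comp_σ {m : ℕ} (a : Splitting.IndexSet (op ⦋m + 1⦌))
    {i : Fin (m + 1)} (h : a.e.toOrderHom i.castSucc = a.e.toOrderHom i.succ) :
    ∃ g : splittingSummand s a ⟶ X _⦋m⦌, splittingInj s a = g ≫ X.σ i := by
  obtain ⟨θ, hθ⟩ := SimplexCategory.eq_σ_comp_of_not_injective' a.e i h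
  have hX : X.map a.e.op = X.map θ.op ≫ X.σ i :=
    (congrArg (fun f => X.map f.op) hθ).trans (X.map_comp θ.op (SimplexCategory.σ i).op)
  exact ⟨s.ι _ ≫ X.map θ.op,
    (congrArg (s.ι _ ≫ ·) hX).trans (Category.assoc (s.ι _) (X.map θ.op) (X.σ i)).symm⟩

variable [HasZeroMorphisms A]

open Classical in
/-- The projection from the `Δ`-simplices of a split simplicial object onto a summand. -/
noncomputable def splittingProj (a : Splitting.IndexSet Δ) : X.obj Δ ⟶ splittingSummand s a :=
  s.desc Δ fun b => if h : b = a then eqToHom (congrArg (splittingSummand s) h) else 0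

theorem splittingInj_proj_self (a : Splitting.IndexSet Δ) :
    splittingInj s a ≫ splittingProj s a = 𝟙 (splittingSummand s a) :=
  (s.ι_desc Δ _ a).trans (dif_pos rfl)

theorem splittingInj_proj_of_ne {a b : Splitting.IndexSet Δ} (h : b ≠ a) :
    splittingInj s b ≫ splittingProj s a = 0 :=
  (s.ι_desc Δ _ b).trans (dif_neg h)

theorem σ_splittingProj {m : ℕ} (a : Splitting.IndexSet (op ⦋m + 1⦌)) {i : Fin (m + 1)}
    (h : a.e.toOrderHom i.castSucc ≠ a.e.toOrderHom i.succ) :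
    X.σ i ≫ splittingProj s a = 0 := by
  refine splitting_hom_ext s fun b => ?_
  have : Epi (SimplexCategory.σ i).op.unop := inferInstanceAs (Epi (SimplexCategory.σ i))
  have hb : splittingInj s b ≫ X.σ i =
      splittingInj s (b.epiComp (SimplexCategory.σ i).op) :=
    s.cofan_inj_epi_naturality b (SimplexCategory.σ i).op
  have hne : b.epiComp (SimplexCategory.σ i).op ≠ a := by
    rintro rfl
    refine h (congrArg b.e.toOrderHom ?_)
    change (SimplexCategory.σ i).toOrderHom i.castSucc = (SimplexCategory.σ i).toOrderHom i.succ
    simp [SimplexCategory.σ, SimplexCategory.mkHom]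
  rw [comp_zero, ← Category.assoc, hb]
  exact splittingInj_proj_of_ne s hne

end Splitting

theorem sum_splittingProj_inj {A : Type u₁} [Category.{v₁} A] [Preadditive A]
    {X : SimplicialObject A} (s : Splitting X) (Δ : SimplexCategoryᵒᵖ) :
    ∑ a : Splitting.IndexSet Δ, splittingProj s a ≫ splittingInj s a = 𝟙 (X.obj Δ) := by
  refine splitting_hom_ext s fun b => ?_
  rw [Preadditive.comp_sum, Finset.sum_eq_single b]
  · rw [← Category.assoc, splittingInj_proj_self, Category.id_comp, Category.comp_id]
  · intro a _ h
    rw [← Category.assoc, splittingInj_proj_of_ne s h.symm, zero_comp]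
  · simp

/-! ### The length of Dold-Puppe complexes -/

section DoldPuppeLength

variable {A : Type u₁} [Category.{v₁} A] {B : Type u₂} [Category.{v₂} B] [Abelian B]

/-- The quotient map `F(Xₙ) ⟶ N(FX)ₙ` vanishes on the images of the `F(sᵢ)`. -/
theorem exists_epi_normalizedX (F : A ⥤ B) (X : SimplicialObject A) (m : ℕ) :
    ∃ p : F.obj (X _⦋m + 1⦌) ⟶ normalizedX (((whiskering A B).obj F).obj X) (m + 1),
      Epi p ∧ ∀ i : Fin (m + 1), F.map (X.σ i) ≫ p = 0 :=
  ⟨normalizedπ (((whiskering A B).obj F).obj X) (m + 1),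
    inferInstanceAs (Epi (normalizedπ (((whiskering A B).obj F).obj X) (m + 1))),
    fun i => σ_normalizedπ (((whiskering A B).obj F).obj X) i⟩

/-- A morphism that vanishes on the images of the `F(sᵢ)` factors through `N(FX)ₙ`. -/
theorem eq_zero_of_isZero_normalizedX (F : A ⥤ B) (X : SimplicialObject A) {m : ℕ} {Z : B}
    (h : IsZero (normalizedX (((whiskering A B).obj F).obj X) (m + 1)))
    (g : F.obj (X _⦋m + 1⦌) ⟶ Z) (hg : ∀ i : Fin (m + 1), F.map (X.σ i) ≫ g = 0) : g = 0 := by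
  have hp := (cokernel.π_desc _ _
    (degenerate_arrow_comp (((whiskering A B).obj F).obj X) g hg)).symm
  exact hp.trans ((congrArg (_ ≫ ·) (h.eq_of_src _ 0)).trans comp_zero)

variable [Preadditive A] [HasFiniteBiproducts A]

theorem isZero_normalizedX_of_length_mul_degree_lt (F : A ⥤ B) (C : ChainComplex A ℕ) {n : ℕ}
    (h : length C * degree F < n) :
    IsZero (normalizedX (((whiskering A B).obj F).obj (DoldKan.Γ₀.obj C)) n) := by
  classical
  obtain ⟨m, rfl⟩ : ∃ m, n = m + 1 := Nat.exists_eq_succ_of_ne_zero (by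
    rintro rfl
    simp at h)
  obtain ⟨p, hp, hpσ⟩ := exists_epi_normalizedX F (DoldKan.Γ₀.obj C) m
  let s : Splitting (DoldKan.Γ₀.obj C) := DoldKan.Γ₀.splitting C
  let e : Splitting.IndexSet (op ⦋m + 1⦌) → 
      ((DoldKan.Γ₀.obj C) _⦋m + 1⦌ ⟶ (DoldKan.Γ₀.obj C) _⦋m + 1⦌) :=
    fun a => splittingProj s a ≫ splittingInj s a
  let J : Finset (Splitting.IndexSet (op ⦋m + 1⦌)) :=
    Finset.univ.filter fun a => ¬ IsZero (C.X a.1.unop.len)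
  have hJ : ∑ a ∈ J, e a = 𝟙 _ := by
    rw [← sum_splittingProj_inj s (op ⦋m + 1⦌)]
    refine Finset.sum_filter_of_ne fun a _ ha hz => ha ?_
    change splittingProj s a ≫ _ = 0
    have hz' : IsZero (splittingSummand s a) := hz
    rw [hz'.eq_of_tgt (splittingProj s a) 0, zero_comp]
  have hU : ∀ U ⊆ J, (U.card : ℕ∞) ≤ degree F →
      F.map (∑ a ∈ U, e a) ≫ p = 0 := by
    intro U hUJ hUd
    have hlen : ∀ a ∈ U, (a.1.unop.len : ℕ∞) ≤ length C := fun a ha => by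
      by_contra! hlt
      exact (Finset.mem_filter.1 (hUJ ha)).2 (isZero_of_length_lt hlt)
    have hsum : ∑ a ∈ U, a.1.unop.len < m + 1 := by
      rw [← Nat.cast_lt (α := ℕ∞)]
      refine lt_of_le_of_lt ?_ h
      rw [Nat.cast_sum]
      refine (Finset.sum_le_card_nsmul U _ _ hlen).trans ?_
      rw [nsmul_eq_mul, mul_comm]
      gcongr
    obtain ⟨i, hi⟩ := exists_forall_castSucc_eq_succ
      (fun a : Splitting.IndexSet (op ⦋m + 1⦌) => a.e.toOrderHom) U hsum
    have hfac : ∃ g, ∑ a ∈ U, e a = g ≫ (DoldKan.Γ₀.obj C).σ i := by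
      choose! g hg using fun a (ha : a ∈ U) => exists_splittingInj_eq_comp_σ s a (hi a ha)
      refine ⟨∑ a ∈ U, splittingProj s a ≫ g a, ?_⟩
      rw [Preadditive.sum_comp]
      refine Finset.sum_congr rfl fun a ha => ?_
      rw [Category.assoc, ← hg a ha]
    obtain ⟨g, hg⟩ := hfac
    rw [hg, F.map_comp, Category.assoc, hpσ, comp_zero]
  have hid : F.map (∑ a ∈ J, e a) ≫ p = 0 := by
    cases hd : degree F with
    | top => exact hU J subset_rfl (by simp [hd])
    | coe d =>
      refine map_sum_comp_eq_zero F (hasDegreeLT_of_degree_eq hd) e _ J fun U hUJ hUd => ?_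
      exact hU U hUJ (by rw [hd]; exact Nat.cast_le.2 hUd)
  rw [hJ, F.map_id, Category.id_comp] at hid
  rw [IsZero.iff_id_eq_zero, ← cancel_epi p, hid, zero_comp, zero_comp]

/-- The summands of `Γ(C)_{ld}` indexed by the `d` surjections `[ld] ↠ [l]` that jump in
consecutive blocks of length `l` give a copy of `cr_d(F)(C_l, …, C_l)` in `F(Γ(C)_{ld})`. Every
index is a jump of one of them, so this copy survives in the quotient by degeneracies. -/
theorem not_isZero_normalizedX_mul (F : A ⥤ B)
    (hF : ∀ Z : A, IsZero Z → IsZero (F.obj Z)) (C : ChainComplex A ℕ) {l d : ℕ}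
    (hl : 0 < l) (hd : 0 < d)
    (h : ¬ IsZero ((crossEffect F d).obj fun _ : Fin d => C.X l)) :
    ¬ IsZero (normalizedX (((whiskering A B).obj F).obj (DoldKan.Γ₀.obj C)) (l * d)) := by
  classical
  rw [isZero_crossEffect_obj_iff] at h
  obtain ⟨m, hm⟩ : ∃ m, l * d = m + 1 :=
    Nat.exists_eq_succ_of_ne_zero (Nat.mul_pos hl hd).ne'
  rw [hm]
  intro hz
  apply h
  let s : Splitting (DoldKan.Γ₀.obj C) := DoldKan.Γ₀.splitting C
  have hjl : ∀ j : Fin d, (j + 1) * l ≤ m + 1 := fun j => by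
    rw [← hm, mul_comm]
    exact Nat.mul_le_mul_left l j.2
  let θ : Fin d → ((⦋m + 1⦌ : SimplexCategory) ⟶ ⦋l⦌) := fun j =>
    SimplexCategory.mkHom (blockHom (m + 1) l j)
  have hθ : ∀ j, Epi (θ j) := fun j =>
    SimplexCategory.epi_iff_surjective.2 (blockHom_surjective (hjl j))
  let a : Fin d → Splitting.IndexSet (op ⦋m + 1⦌) := fun j => Splitting.IndexSet.mk (θ j)
  have ha : Function.Injective a := by
    intro j j' hjj'
    have hθθ : θ j = θ j' := by
      have := (Sigma.mk.inj_iff.1 hjj').2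
      exact congrArg Subtype.val (eq_of_heq this)
    have hb : blockHom (m + 1) l j = blockHom (m + 1) l j' :=
      congrArg SimplexCategory.Hom.toOrderHom hθθ
    exact Fin.ext (le_antisymm (blockHom_injective hl (hjl j') hb.symm)
      (blockHom_injective hl (hjl j) hb))
  let inc : ∀ j : Fin d, C.X l ⟶ (DoldKan.Γ₀.obj C) _⦋m + 1⦌ := fun j => splittingInj s (a j)
  let pr : ∀ j : Fin d, (DoldKan.Γ₀.obj C) _⦋m + 1⦌ ⟶ C.X l := fun j => splittingProj s (a j)
  have hinc : biproduct.desc inc ≫ biproduct.lift pr = 𝟙 _ := by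
    refine biproduct.hom_ext' _ _ fun j => biproduct.hom_ext _ _ fun j' => ?_
    simp only [Category.assoc, biproduct.lift_π, biproduct.ι_desc_assoc, Category.comp_id]
    by_cases hjj' : j = j'
    · subst hjj'
      rw [biproduct.ι_π_self]
      exact splittingInj_proj_self s (a j)
    · rw [biproduct.ι_π_ne _ hjj']
      exact splittingInj_proj_of_ne s (ha.ne hjj')
  have hzero : F.map (biproduct.lift pr) ≫ deviation F (psi fun _ : Fin d => C.X l) = 0 := by
    refine eq_zero_of_isZero_normalizedX F _ hz _ fun i => ?_
    -- The index `i` lies in the block with number `i / l`.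
    have hi : (i : ℕ) / l < d := Nat.div_lt_of_lt_mul (by omega)
    rw [← Category.assoc, ← F.map_comp, comp_deviation]
    refine deviation_eq_zero_of_apply_eq_zero F hF _ (j := ⟨i / l, hi⟩) ?_
    have hσ : (DoldKan.Γ₀.obj C).σ i ≫ pr ⟨i / l, hi⟩ = 0 :=
      σ_splittingProj s (a ⟨i / l, hi⟩) (blockHom_castSucc_ne_succ hl i)
    rw [psi, Category.assoc, biproduct.lift_π_assoc, ← Category.assoc, hσ, zero_comp]
  calc deviation F (psi fun _ : Fin d => C.X l)
      = F.map (biproduct.desc inc ≫ biproduct.lift pr) ≫ deviation F (psi _) := by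
        rw [hinc, F.map_id, Category.id_comp]
    _ = 0 := by rw [F.map_comp, Category.assoc, hzero, comp_zero]

end DoldPuppeLength

end DoldPuppe

theorem mainTheorem2 {A : Type u₁} [Category.{v₁} A] [Preadditive A] [HasFiniteBiproducts A]
    {B : Type u₂} [Category.{v₂} B] [Abelian B]
    (F : A ⥤ B) (hF : ∀ Z : A, IsZero Z → IsZero (F.obj Z)) (C : ChainComplex A ℕ) :
    DoldPuppe.length (DoldPuppe.complex F C) ≤ DoldPuppe.length C * DoldPuppe.degree F ∧
    ∀ l d : ℕ, DoldPuppe.length C = l → DoldPuppe.degree F = d →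
      ¬ IsZero ((DoldPuppe.crossEffect F d).obj fun _ : Fin d => C.X l) →
      DoldPuppe.length (DoldPuppe.complex F C) = DoldPuppe.length C * DoldPuppe.degree F := by
  have hle : DoldPuppe.length (DoldPuppe.complex F C) ≤
      DoldPuppe.length C * DoldPuppe.degree F :=
    DoldPuppe.length_le fun _ hn => DoldPuppe.isZero_normalizedX_of_length_mul_degree_lt F C hn
  refine ⟨hle, fun l d hl hd hcr => le_antisymm hle ?_⟩
  rw [hl, hd]
  rcases Nat.eq_zero_or_pos l with rfl | hl₀
  · simp
  rcases Nat.eq_zero_or_pos d with rfl | hd₀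
  · simp
  by_contra! hlt
  rw [← Nat.cast_mul] at hlt
  exact DoldPuppe.not_isZero_normalizedX_mul F hF C hl₀ hd₀ hcr
    (DoldPuppe.isZero_of_length_lt hlt)
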